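/- Let $k$ be an algebraically closed field of characteristic $2$ and let $n\ge 3$. Notation. For elements $a_1,\dots,a_r$ of a commutative ring of characteristic $2$, let $\Delta_r(a_1,\dots,a_r)=\det\big(a_j^{2^{i-1}}\big)_{1\le i,j\le r}$ be the Moore determinant; $\hat{\underline a}_i$ denotes the tuple $\underline a$ with its $i$-th entry removed. A differential form $\omega=f(X)\,dX$ on $\mathbb P^1_k$ ($f\in k(X)$) is logarithmic if $\omega=dF/F$ for some $F\in k(X)^\times$. For integers $m,n\ge 1$, a space $L_{m+1,n}$ is an $n$-dimensional $\mathbb F_2$-vector space of differential forms on $\mathbb P^1_k$ such that every nonzero element is logarithmic and has a unique zero, which is at $\infty$ and has order $m-1$. Let $\underline Q=(Q_1,\dots,Q_n)\in k[X]^n$ be polynomials of a common degree $\lambda\ge 1$ whose leading coefficients $q_i$ satisfy $\Delta_n(q_1,\dots,q_n)\neq 0$, and put $\omega_i=(-1)^{i-1}\frac{\Delta_{n-1}(\hat{\underline Q}_i)}{\Delta_n(\underline Q)}\,dX$. We say that $\underline Q$ gives rise to a basis of a space $L_{2^{n-1}\lambda,n}$ if $\omega_1,\dots,\omega_n$ form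 a basis over $\mathbb F_2$ of a space $L_{2^{n-1}\lambda,n}$. Theorem. Let $W_1,\dots,W_n\in k[X]$ be linearly independent over $\mathbb F_2$ and such that all nonzero elements of $\langle W_1,\dots,W_n\rangle_{\mathbb F_2}$ have the same degree $d\ge 0$ and any two distinct ones are coprime (so that $\Delta_n(\underline W)\ne 0$). Set $V_i=\Delta_{n-1}(\hat{\underline W}_i)$ for $i=1,\dots,n$. Then there is a rational function $\alpha\in\frac{1}{\Delta_n(\underline W)}k[X]$ with the following two properties: (i) $Q_i:=\dfrac{V_i^4}{\Delta_n(\underline W)^2}+(X+\alpha^2)V_i^2$ is a polynomial for every $i=1,\dots,n$; (ii) the polynomials $Q_1,\dots,Q_n$ have a common degree $\lambda\ge 1$ and $(Q_1,\dots,Q_n)$ gives rise to a basis of a space $L_{2^{n-1}\lambda,n}$. Moreover, for every $\alpha\in k(X)$ satisfying (i) and (ii), the set of all rational functions in $k(X)$ satisfying (i) and (ii) is exactly $\{\alpha+R : R\in k[X]\}$. -/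

import Mathlib

open Polynomial
open scoped KaehlerDifferential

/-- The Moore determinant `Δ_n(a₁, …, a_n)`: the determinant of the `n × n` matrix whose rows are
`a`, `a ^ p`, …, `a ^ (p ^ (n - 1))`. -/
noncomputable def moore {R : Type*} [CommRing R] (p : ℕ) {n : ℕ} (a : Fin n → R) : R :=
  Matrix.det (Matrix.of fun i j : Fin n => a j ^ p ^ (i : ℕ))

/-- `Δ_{n-1}(â_i)`: the Moore determinant of the `(n-1)`-tuple obtained from `a` by removing its
`i`-th entry. -/
noncomputable def mooreHat {R : Type*} [CommRing R] (p : ℕ) :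
    {n : ℕ} → (Fin n → R) → Fin n → R
  | 0, _, i => i.elim0
  | _ + 1, a, i => moore p (i.removeNth a)

section Forms

variable {k : Type*} [Field k]

/-- The order at a point `a ∈ k` of the (nonzero) rational function `f`. -/
noncomputable def ordAt (f : RatFunc k) (a : k) : ℤ :=
  (f.num.rootMultiplicity a : ℤ) - (f.denom.rootMultiplicity a : ℤ)

/-- The differential form `f(X) dX` on the projective line. -/
noncomputable def dForm (f : RatFunc k) : Ω[RatFunc k⁄k] :=
  f • KaehlerDifferential.D k (RatFunc k) RatFunc.X

/-- A differential form is logarithmic if it is `dF / F` for some nonzero `F ∈ k(X)`. -/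
def IsLogarithmic (ω : Ω[RatFunc k⁄k]) : Prop :=
  ∃ F : RatFunc k, F ≠ 0 ∧ ω = F⁻¹ • KaehlerDifferential.D k (RatFunc k) F

/-- The nonzero form `ω = f(X) dX` has no zero on the affine line and has order `r` at infinity.
The order at infinity of `f(X) dX` is `ord_0 (f(1/X)) - 2 = - deg f - 2`. -/
def HasOnlyZeroAtInfty (ω : Ω[RatFunc k⁄k]) (r : ℤ) : Prop :=
  ∃ f : RatFunc k, ω = dForm f ∧ (∀ a : k, ordAt f a ≤ 0) ∧ -f.intDegree - 2 = r

/-- `Om` is a space `L_{N,n}` (with `N = m + 1`, where `m, n ≥ 1`): an `n`-dimensional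
`𝔽_p`-vector space of differential forms on the projective line, all of whose nonzero elements are
logarithmic and have a unique zero, which is at infinity and of order `m - 1 = N - 2`. -/
structure IsSpaceL (p : ℕ) [Fact p.Prime] [Algebra (ZMod p) k] (N n : ℕ)
    (Om : Submodule (ZMod p) (Ω[RatFunc k⁄k])) : Prop where
  two_le : 2 ≤ N
  one_le : 1 ≤ n
  finrank_eq : Module.finrank (ZMod p) Om = n
  logarithmic : ∀ ω ∈ Om, ω ≠ 0 → IsLogarithmic ω
  zero_infty : ∀ ω ∈ Om, ω ≠ 0 → HasOnlyZeroAtInfty ω ((N : ℤ) - 2)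

/-- The differential forms `ω_i = (-1)^(i-1) Δ_{n-1}(Q̂_i) / Δ_n(Q) dX` attached to a tuple of
polynomials (indices start at `0` here, whence the exponent `i` of the sign). -/
noncomputable def omegaOf (p : ℕ) {n : ℕ} (Q : Fin n → k[X]) (i : Fin n) : Ω[RatFunc k⁄k] :=
  dForm (algebraMap k[X] (RatFunc k) ((-1) ^ (i : ℕ) * mooreHat p Q i) /
    algebraMap k[X] (RatFunc k) (moore p Q))

/-- The tuple `Q` of polynomials, all of degree `l ≥ 1` and with leading coefficients whose Moore
determinant does not vanish, gives rise to a basis `(ω_1, …, ω_n)` of a space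
`L_{l p^(n-1), n}`. -/
structure GivesRiseToSpaceL (p : ℕ) [Fact p.Prime] [Algebra (ZMod p) k] {n : ℕ} (l : ℕ)
    (Q : Fin n → k[X]) : Prop where
  one_le : 1 ≤ l
  natDegree_eq : ∀ i, (Q i).natDegree = l
  moore_leadingCoeff : moore p (fun i => (Q i).leadingCoeff) ≠ 0
  linearIndependent : LinearIndependent (ZMod p) (omegaOf p Q)
  isSpaceL : IsSpaceL p (l * p ^ (n - 1)) n (Submodule.span (ZMod p) (Set.range (omegaOf p Q)))

/-- The rational function `V_i ^ 4 / Δ_n(W) ^ 2 + (X + α ^ 2) V_i ^ 2`, with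
`V_i = Δ_{n-1}(Ŵ_i)`. -/
noncomputable def ratQ {n : ℕ} (W : Fin n → k[X]) (α : RatFunc k) (i : Fin n) : RatFunc k :=
  algebraMap k[X] (RatFunc k) (mooreHat 2 W i) ^ 4 /
      algebraMap k[X] (RatFunc k) (moore 2 W) ^ 2 +
    (RatFunc.X + α ^ 2) * algebraMap k[X] (RatFunc k) (mooreHat 2 W i) ^ 2

/-- The two properties required of `α`: the rational functions `Q_i` are polynomials, and the tuple
of these polynomials gives rise to a basis of a space `L_{l 2^(n-1), n}`, where `l` is their common
degree. -/
def IsAdmissible [Algebra (ZMod 2) k] {n : ℕ} (W : Fin n → k[X]) (α : RatFunc k) : Prop :=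
  ∃ Q : Fin n → k[X], (∀ i, algebraMap k[X] (RatFunc k) (Q i) = ratQ W α i) ∧
    ∃ l : ℕ, GivesRiseToSpaceL 2 l Q

end Forms

/-! Put Δ = Δ_n(W), g_j = V_j/Δ, β = X + α², so that Q_j = Δ²(g_j⁴ + βg_j²), and let f_j =
Δ_{n-1}(Q̂_j)/Δ_n(Q), so that ω_j = f_j dX. If df = f² dX with f ≠ 0, then f dX = df/f is
logarithmic; in characteristic 2 this equation passes to 𝔽₂-combinations. The f_j are determined by
Σ f_j Q_j^(2^i) = 0 for i < n-1 and = 1 for i = n-1. Differentiating these relations reduces df_j =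
f_j² dX to the single identity Σ f_j dQ_j = (Σ f_j² Q_j) dX (`derivation_mooreDual`). As dQ_j = V_j²
dX, this is a statement about the sums Σ f_j g_j^(2^i), proved in `sum_mooreDual_relation` from the
additive polynomial that kills the g_j. The divisor condition holds because a Moore minor divides
the full determinant: each nonzero combination of the f_j is 1/P with deg P = λ2^(n-1)
(`exists_sum_smul_mooreDual_eq_inv`).

Property (ii) thus follows from (i), and (i) is arithmetic. Up to a unit, Δ is the product of the
nonzero w in the span of W; modulo each w the V_j are 0 or one common value, so the Chinese
remainder theorem yields γ with Δ ∣ V_j(V_j + γ), and α = γ/Δ works. Two solutions differ by δ with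
every δ²V_i² a polynomial; since the V_i generate the unit ideal, δ is a polynomial. -/

/-! ### Moore determinants and their minors over a commutative ring. -/

section MooreAlgebra

open Finset Matrix

variable {R : Type*} [CommRing R]

/-- The matrix whose first rows are the Frobenius powers of `a` and whose last row is `x`. -/
def mooreRow {m : ℕ} (a x : Fin (m + 1) → R) : Matrix (Fin (m + 1)) (Fin (m + 1)) R :=
  Matrix.of fun i j => Fin.lastCases (motive := fun _ => R) (x j) (fun i => a j ^ 2 ^ (i : ℕ)) i

@[simp]
theorem mooreRow_last {m : ℕ} (a x : Fin (m + 1) → R) (j : Fin (m + 1)) :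
    mooreRow a x (Fin.last m) j = x j := by
  simp [mooreRow]

@[simp]
theorem mooreRow_castSucc {m : ℕ} (a x : Fin (m + 1) → R) (i : Fin m) (j : Fin (m + 1)) :
    mooreRow a x i.castSucc j = a j ^ 2 ^ (i : ℕ) := by
  simp [mooreRow]

theorem moore_map {S : Type*} [CommRing S] (f : R →+* S) {n : ℕ} (a : Fin n → R) :
    moore 2 (fun j => f (a j)) = f (moore 2 a) := by
  rw [moore, moore, RingHom.map_det]
  congr 1
  ext i j
  simp

theorem mooreHat_map {S : Type*} [CommRing S] (f : R →+* S) {n : ℕ} (a : Fin (n + 1) → R)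
    (j : Fin (n + 1)) : mooreHat 2 (fun j => f (a j)) j = f (mooreHat 2 a j) :=
  moore_map f (j.removeNth a)

theorem moore_mul_left {n : ℕ} (c : R) (a : Fin n → R) :
    moore 2 (fun j => c * a j) = (∏ i : Fin n, c ^ 2 ^ (i : ℕ)) * moore 2 a := by
  rw [moore, moore, ← Matrix.det_mul_column]
  congr 1
  ext i j
  simp [mul_pow]

/-- Since adj(N)·N·e = det(N)·e, the coordinate where e is 1 exhibits det N as a combination of the
entries of N·e. -/
theorem dvd_det_of_dvd_mulVec {n : ℕ} (N : Matrix (Fin n) (Fin n) R) (e : Fin n → R) {i₀ : Fin n}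
    (h₀ : e i₀ = 1) {w : R} (h : ∀ i, w ∣ (N *ᵥ e) i) : w ∣ N.det := by
  have h1 : N.det = (N.adjugate *ᵥ (N *ᵥ e)) i₀ := by
    rw [mulVec_mulVec, adjugate_mul, smul_mulVec, one_mulVec]
    simp [h₀]
  rw [h1, mulVec, dotProduct]
  exact dvd_sum fun i _ => dvd_mul_of_dvd_right (h i) _

theorem algebraMap_pow_two_pow [Algebra (ZMod 2) R] (c : ZMod 2) (i : ℕ) :
    algebraMap (ZMod 2) R c ^ 2 ^ i = algebraMap (ZMod 2) R c := by
  rw [← map_pow, ZMod.pow_card_pow]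

variable [CharP R 2]

theorem moore_sq {n : ℕ} (a : Fin n → R) : moore 2 (fun j => a j ^ 2) = moore 2 a ^ 2 :=
  moore_map (frobenius R 2) a

theorem neg_one_pow_char_two (i : ℕ) : (-1 : R) ^ i = 1 := by
  rw [CharTwo.neg_eq, one_pow]

/-- Laplace expansion along the last row. Taking for x a Frobenius power of a gives the
orthogonality relations below. -/
theorem sum_mooreHat_mul {m : ℕ} (a x : Fin (m + 1) → R) :
    ∑ j, mooreHat 2 a j * x j = (mooreRow a x).det := by
  rw [Matrix.det_succ_row _ (Fin.last m)]
  refine sum_congr rfl fun j _ => ?_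
  rw [neg_one_pow_char_two, one_mul, mooreRow_last, mul_comm]
  congr 1
  rw [mooreHat, moore]
  congr 1
  ext i l
  simp [Fin.removeNth]

theorem sum_mooreHat_mul_pow_of_lt {m : ℕ} (a : Fin (m + 1) → R) {i : ℕ} (hi : i < m) :
    ∑ j, mooreHat 2 a j * a j ^ 2 ^ i = 0 := by
  rw [sum_mooreHat_mul]
  refine Matrix.det_zero_of_row_eq (Fin.castSucc_lt_last ⟨i, hi⟩).ne ?_
  ext j
  rw [mooreRow_last]
  exact mooreRow_castSucc a _ ⟨i, hi⟩ j

theorem sum_mooreHat_mul_pow {m : ℕ} (a : Fin (m + 1) → R) :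
    ∑ j, mooreHat 2 a j * a j ^ 2 ^ m = moore 2 a := by
  rw [sum_mooreHat_mul, moore]
  congr 1
  ext i j
  refine Fin.lastCases ?_ (fun i => ?_) i <;> simp

/-- Expansion along the first row: the remaining rows are the Frobenius twist of a Moore matrix, so
the minors are squares. -/
theorem sum_mul_mooreHat_sq {m : ℕ} (a : Fin (m + 1) → R) :
    ∑ j, a j * mooreHat 2 a j ^ 2 = moore 2 a := by
  conv_rhs => rw [moore, Matrix.det_succ_row _ 0]
  refine sum_congr rfl fun j _ => ?_
  rw [neg_one_pow_char_two, one_mul, mooreHat, ← moore_sq, moore]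
  simp only [of_apply, Fin.val_zero, pow_zero, pow_one]
  congr 2
  ext i l
  simp [Fin.removeNth, pow_mul, pow_succ']

section

variable [Algebra (ZMod 2) R]

theorem sum_smul_pow_two_pow {ι : Type*} [Fintype ι] (e : ι → ZMod 2) (a : ι → R) (i : ℕ) :
    (∑ j, e j • a j) ^ 2 ^ i = ∑ j, a j ^ 2 ^ i * algebraMap (ZMod 2) R (e j) := by
  rw [sum_pow_char_pow]
  simp only [Algebra.smul_def, mul_pow, algebraMap_pow_two_pow, mul_comm]

theorem sum_smul_dvd_mooreRow {m : ℕ} (a x : Fin (m + 1) → R) (e : Fin (m + 1) → ZMod 2)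
    {i₀ : Fin (m + 1)} (h₀ : e i₀ = 1) (hx : ∑ j, e j • a j ∣ ∑ j, e j • x j) :
    ∑ j, e j • a j ∣ (mooreRow a x).det := by
  refine dvd_det_of_dvd_mulVec _ (fun j => algebraMap (ZMod 2) R (e j)) (i₀ := i₀) (by simp [h₀])
    fun i => ?_
  rw [mulVec, dotProduct]
  refine Fin.lastCases ?_ (fun i => ?_) i
  · simpa [Algebra.smul_def, mul_comm] using hx
  · simp only [mooreRow_castSucc]
    rw [← sum_smul_pow_two_pow]
    exact dvd_pow_self _ (by positivity)

theorem sum_smul_dvd_moore {m : ℕ} (a : Fin m → R) (e : Fin m → ZMod 2)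
    {i₀ : Fin m} (h₀ : e i₀ = 1) : ∑ j, e j • a j ∣ moore 2 a := by
  refine dvd_det_of_dvd_mulVec _ (fun j => algebraMap (ZMod 2) R (e j)) (i₀ := i₀) (by simp [h₀])
    fun i => ?_
  rw [mulVec, dotProduct]
  simp only [of_apply]
  rw [← sum_smul_pow_two_pow]
  exact dvd_pow_self _ (by positivity)

theorem zmod_two_eq_one {c : ZMod 2} (h : c ≠ 0) : c = 1 := by
  revert c; decide

theorem exists_eq_one_of_ne_zero {ι : Type*} {e : ι → ZMod 2} (h : e ≠ 0) : ∃ i, e i = 1 := by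
  obtain ⟨i, hi⟩ := Function.ne_iff.mp h
  exact ⟨i, zmod_two_eq_one hi⟩

theorem linearIndependent_of_moore_ne_zero {m : ℕ} {a : Fin m → R} (h : moore 2 a ≠ 0) :
    LinearIndependent (ZMod 2) a := by
  rw [Fintype.linearIndependent_iff]
  intro e he
  by_contra hne
  obtain ⟨i₀, h₀⟩ := exists_eq_one_of_ne_zero (e := e) fun h => hne (by simp [h])
  have := sum_smul_dvd_moore a e h₀
  rw [he, zero_dvd_iff] at this
  exact h this

/-- Modulo `w = ∑ e_j a_j`, the tuple of the `mooreHat 2 a j` is proportional to `e`. -/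
theorem sum_smul_dvd_mooreHat {m : ℕ} (a : Fin (m + 1) → R) (e : Fin (m + 1) → ZMod 2)
    {i₀ : Fin (m + 1)} (h₀ : e i₀ = 1) (j : Fin (m + 1)) :
    ∑ l, e l • a l ∣ mooreHat 2 a j + e j • mooreHat 2 a i₀ := by
  -- The row x, with 1 at j plus e_j at i₀, pairs with e to e_j + e_j = 0, which every element
  -- divides.
  have h := sum_smul_dvd_mooreRow a
    (fun l => (Pi.single j 1 : Fin (m + 1) → R) l +
      (Pi.single i₀ (algebraMap (ZMod 2) R (e j)) : Fin (m + 1) → R) l) e h₀ (by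
      simp only [sum_add_distrib, Algebra.smul_def, Pi.single_apply, mul_add, mul_ite, mul_one,
        mul_zero, sum_ite_eq', mem_univ, if_true, h₀, map_one, one_mul]
      rw [CharTwo.add_self_eq_zero]
      exact dvd_zero _)
  rw [← sum_mooreHat_mul] at h
  simpa [mul_add, sum_add_distrib, Pi.single_apply, Algebra.smul_def, mul_comm] using h

/-- The tuple obtained from `a` by adding `e_j a_{i₀}` to `a_j` for `j ≠ i₀`. -/
def shear {m : ℕ} (a : Fin m → R) (e : Fin m → ZMod 2) (i₀ : Fin m) (j : Fin m) : R :=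
  a j + Function.update e i₀ 0 j • a i₀

theorem det_mooreRow_shear {m : ℕ} (a x : Fin (m + 1) → R) (e : Fin (m + 1) → ZMod 2)
    (i₀ : Fin (m + 1)) :
    (mooreRow (shear a e i₀) (shear x e i₀)).det = (mooreRow a x).det := by
  rw [← Matrix.det_transpose, ← Matrix.det_transpose (mooreRow a x)]
  refine Matrix.det_eq_of_forall_row_eq_smul_add_const
    (fun j => algebraMap (ZMod 2) R (Function.update e i₀ 0 j)) i₀ (by simp) fun j i => ?_
  refine Fin.lastCases ?_ (fun i => ?_) i
  · simp [shear, Algebra.smul_def]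
  · simp [shear, Algebra.smul_def, add_pow_char_pow, mul_pow, algebraMap_pow_two_pow]

theorem moore_shear {m : ℕ} (a : Fin (m + 1) → R) (e : Fin (m + 1) → ZMod 2) (i₀ : Fin (m + 1)) :
    moore 2 (shear a e i₀) = moore 2 a := by
  rw [← sum_mooreHat_mul_pow, ← sum_mooreHat_mul_pow, sum_mooreHat_mul, sum_mooreHat_mul,
    ← det_mooreRow_shear a _ e i₀]
  congr 2
  ext j
  simp [shear, Algebra.smul_def, add_pow_char_pow, mul_pow, algebraMap_pow_two_pow]

/-- A unipotent change of tuple turns a combination of minors into a single minor, to which degree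
and divisibility results apply. -/
theorem sum_smul_mooreHat {m : ℕ} (a : Fin (m + 1) → R) (e : Fin (m + 1) → ZMod 2)
    {i₀ : Fin (m + 1)} (h₀ : e i₀ = 1) :
    ∑ j, e j • mooreHat 2 a j = mooreHat 2 (shear a e i₀) i₀ := by
  have h1 : mooreHat 2 (shear a e i₀) i₀ =
      ∑ j, mooreHat 2 (shear a e i₀) j * (Pi.single i₀ 1 : Fin (m + 1) → R) j := by
    simp [Pi.single_apply]
  have h2 : ∑ j, e j • mooreHat 2 a j =
      ∑ j, mooreHat 2 a j * algebraMap (ZMod 2) R (e j) := by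
    simp [Algebra.smul_def, mul_comm]
  rw [h1, h2, sum_mooreHat_mul, sum_mooreHat_mul, ← det_mooreRow_shear a _ e i₀]
  congr 2
  ext j
  by_cases hj : j = i₀
  · subst hj; simp [shear, h₀]
  · simp [shear, hj, h₀, Algebra.smul_def, CharTwo.add_self_eq_zero]

end

end MooreAlgebra

/-! ### Moore determinants over a domain: independence and divisibility. -/

section MooreDomain

open Finset Matrix

variable {R : Type*} [CommRing R] [CharP R 2] [Algebra (ZMod 2) R]

theorem injective_sum_smul {ι M : Type*} [Fintype ι] [AddCommGroup M] [Module (ZMod 2) M]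
    {a : ι → M} (h : LinearIndependent (ZMod 2) a) :
    Function.Injective fun e : ι → ZMod 2 => ∑ j, e j • a j := by
  intro e e' hee
  rw [Fintype.linearIndependent_iff] at h
  have := h (e - e') (by simpa [sub_smul, sum_sub_distrib, sub_eq_zero] using hee)
  ext i
  exact sub_eq_zero.mp (this i)

theorem moore_update_eq_zero {m : ℕ} (b : Fin (m + 1) → R) (i₀ : Fin (m + 1))
    (e : Fin m → ZMod 2) :
    moore 2 (Function.update b i₀ (∑ j, e j • i₀.removeNth b j)) = 0 := by
  have h := sum_smul_dvd_moore (Function.update b i₀ (∑ j, e j • i₀.removeNth b j))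
    (i₀.insertNth (α := fun _ => ZMod 2) 1 e) (i₀ := i₀) (by simp)
  rw [Fin.sum_univ_succAbove _ i₀] at h
  simpa [Fin.removeNth, CharTwo.add_self_eq_zero] using h

variable [IsDomain R]

/-- A left kernel vector of the Moore matrix would be an additive polynomial of degree at most
2^(n-1) vanishing on the 2^n elements of the span. -/
theorem moore_ne_zero_of_linearIndependent {n : ℕ} {a : Fin n → R}
    (h : LinearIndependent (ZMod 2) a) : moore 2 a ≠ 0 := by
  intro h0
  obtain ⟨v, hv, hv0⟩ := Matrix.exists_vecMul_eq_zero_iff.mpr h0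
  set F : R[X] := ∑ i : Fin n, C (v i) * X ^ 2 ^ (i : ℕ) with hF
  have hcoeff (i : Fin n) : F.coeff (2 ^ (i : ℕ)) = v i := by
    simp only [hF, finsetSum_coeff, coeff_C_mul, coeff_X_pow]
    rw [sum_eq_single i]
    · simp
    · intro j _ hj
      rw [if_neg, mul_zero]
      intro h'
      exact hj (Fin.ext (Nat.pow_right_injective le_rfl h').symm)
    · simp
  have hF0 : F = 0 := by
    refine eq_zero_of_natDegree_lt_card_of_eval_eq_zero F (injective_sum_smul h) (fun e => ?_) ?_
    · simp only [hF, eval_finsetSum, eval_mul, eval_C, eval_pow, eval_X, sum_smul_pow_two_pow]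
      have h1 : ∀ j, ∑ i : Fin n, v i * a j ^ 2 ^ (i : ℕ) = 0 := fun j => congrFun hv0 j
      simp only [mul_sum]
      rw [sum_comm]
      simp only [← mul_assoc, ← sum_mul, h1, zero_mul, sum_const_zero]
    · rw [Fintype.card_fun, ZMod.card, Fintype.card_fin]
      rcases Nat.eq_zero_or_pos n with rfl | hn
      · simp [hF]
      refine lt_of_le_of_lt (natDegree_sum_le_of_forall_le (n := 2 ^ (n - 1)) _ _ fun i _ => ?_)
        (Nat.pow_lt_pow_right (by norm_num) (by omega))
      exact (natDegree_C_mul_X_pow_le _ _).trans (Nat.pow_le_pow_right (by norm_num) (by omega))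
  refine hv ?_
  ext i
  rw [← hcoeff, hF0]
  simp

/-- As a polynomial in its i₀-th entry, the Moore determinant has degree 2^m and leading coefficient
the minor. Its roots are the 2^m elements of the span of the other entries, so it splits over R
itself. -/
theorem mooreHat_dvd_moore {m : ℕ} (b : Fin (m + 1) → R) (i₀ : Fin (m + 1))
    (h : mooreHat 2 b i₀ ≠ 0) : mooreHat 2 b i₀ ∣ moore 2 b := by
  set N : Fin (m + 1) → R := fun i =>
    (Matrix.of fun (i' : Fin m) (j' : Fin m) =>
      b (i₀.succAbove j') ^ 2 ^ (i.succAbove i' : ℕ)).det with hN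
  have hlast : N (Fin.last m) = mooreHat 2 b i₀ := by
    simp [hN, mooreHat, moore, Fin.removeNth]
  set F : R[X] := ∑ i : Fin (m + 1), C (N i) * X ^ 2 ^ (i : ℕ) with hF
  have heval (t : R) : F.eval t = moore 2 (Function.update b i₀ t) := by
    rw [moore, Matrix.det_succ_column _ i₀]
    simp only [hF, eval_finsetSum, eval_mul, eval_C, eval_pow, eval_X]
    refine sum_congr rfl fun i _ => ?_
    rw [neg_one_pow_char_two, one_mul, mul_comm]
    simp only [of_apply, Function.update_self, hN]
    congr 2
    ext i' j'
    simp
  have hcoeff : F.coeff (2 ^ m) = mooreHat 2 b i₀ := by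
    simp only [hF, finsetSum_coeff, coeff_C_mul, coeff_X_pow]
    rw [sum_eq_single (Fin.last m)]
    · simp [hlast]
    · intro j _ hj
      rw [if_neg, mul_zero]
      intro h'
      exact hj (Fin.ext (Nat.pow_right_injective le_rfl h').symm)
    · simp
  have hle : F.natDegree ≤ 2 ^ m := by
    refine natDegree_sum_le_of_forall_le _ _ fun i _ => ?_
    exact (natDegree_C_mul_X_pow_le _ _).trans
      (Nat.pow_le_pow_right (by norm_num) (Nat.lt_succ_iff.mp i.2))
  have hdeg : F.natDegree = 2 ^ m := natDegree_eq_of_le_of_coeff_ne_zero hle (by rwa [hcoeff])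
  have hF0 : F ≠ 0 := fun h0 => h (by rw [← hcoeff, h0, coeff_zero])
  have hinj := injective_sum_smul (linearIndependent_of_moore_ne_zero (a := i₀.removeNth b) h)
  have hsub : (univ.val.map fun e : Fin m → ZMod 2 => ∑ j, e j • i₀.removeNth b j) ≤ F.roots := by
    rw [Multiset.le_iff_subset (univ.nodup.map hinj)]
    intro x hx
    obtain ⟨e, -, rfl⟩ := Multiset.mem_map.mp hx
    rw [mem_roots hF0, IsRoot, heval, moore_update_eq_zero]
  have hcard : Multiset.card F.roots = F.natDegree := by
    refine le_antisymm (card_roots' F) ?_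
    have := Multiset.card_le_card hsub
    simpa [hdeg, ZMod.card] using this
  have h1 := congrArg (eval (b i₀)) (C_leadingCoeff_mul_prod_multiset_X_sub_C hcard)
  rw [heval, Function.update_eq_self, eval_mul, eval_C, leadingCoeff, hdeg, hcoeff] at h1
  exact ⟨_, h1.symm⟩

end MooreDomain

/-! ### The dual tuple and the differential equation it satisfies. -/

section MooreDual

open Finset Matrix

theorem prod_pow_two_pow {M : Type*} [CommMonoid M] (x : M) (n : ℕ) :
    x * ∏ i : Fin n, x ^ 2 ^ (i : ℕ) = x ^ 2 ^ n := by
  induction n with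
  | zero => simp
  | succ n ih =>
    rw [Fin.prod_univ_castSucc]
    simp only [Fin.val_castSucc, Fin.val_last]
    rw [← mul_assoc, ih, ← pow_add, pow_succ, mul_two]

variable {K : Type*} [Field K] [CharP K 2]

/-- The tuple dual to `a` with respect to the Frobenius powers. -/
noncomputable def mooreDual {m : ℕ} (a : Fin (m + 1) → K) (j : Fin (m + 1)) : K :=
  mooreHat 2 a j / moore 2 a

theorem sum_mooreDual_mul_pow_of_lt {m : ℕ} (a : Fin (m + 1) → K) {i : ℕ} (hi : i < m) :
    ∑ j, mooreDual a j * a j ^ 2 ^ i = 0 := by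
  simp only [mooreDual, div_mul_eq_mul_div, ← sum_div, sum_mooreHat_mul_pow_of_lt a hi, zero_div]

theorem sum_mooreDual_mul_pow {m : ℕ} {a : Fin (m + 1) → K} (ha : moore 2 a ≠ 0) :
    ∑ j, mooreDual a j * a j ^ 2 ^ m = 1 := by
  simp only [mooreDual, div_mul_eq_mul_div, ← sum_div, sum_mooreHat_mul_pow a, div_self ha]

theorem sum_mul_mooreDual_sq {m : ℕ} {a : Fin (m + 1) → K} (ha : moore 2 a ≠ 0) :
    ∑ j, a j * mooreDual a j ^ 2 = (moore 2 a)⁻¹ := by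
  simp only [mooreDual, div_pow, ← mul_div_assoc, ← sum_div, sum_mul_mooreHat_sq a]
  field_simp

/-- The Moore matrix of the squared dual, times the transposed Moore matrix of a, is lower
triangular with diagonal entries Δ^(-2^i). -/
theorem moore_mooreDual_sq {m : ℕ} {a : Fin (m + 1) → K} (ha : moore 2 a ≠ 0) :
    moore 2 (mooreDual a) ^ 2 * moore 2 a ^ 2 ^ (m + 1) = 1 := by
  have h : moore 2 (mooreDual a) ^ 2 * moore 2 a =
      ∏ i : Fin (m + 1), ((moore 2 a)⁻¹) ^ 2 ^ (i : ℕ) := by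
    rw [← moore_sq]
    conv_lhs => rw [moore, moore, ← Matrix.det_transpose
      (Matrix.of fun i j : Fin (m + 1) => a j ^ 2 ^ (i : ℕ)), ← Matrix.det_mul]
    rw [Matrix.det_of_isLowerTriangular]
    · refine prod_congr rfl fun i _ => ?_
      rw [mul_apply, ← sum_mul_mooreDual_sq ha, sum_pow_char_pow]
      refine sum_congr rfl fun j _ => ?_
      simp only [of_apply, transpose_apply]
      ring
    · intro i l hil
      have hil : i < l := hil
      rw [mul_apply]
      -- The entry (i, l) is the 2^(i+1)-th power of this vanishing sum.
      have h1 : ∑ j, mooreDual a j * a j ^ 2 ^ ((l : ℕ) - i - 1) = 0 :=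
        sum_mooreDual_mul_pow_of_lt a (by omega)
      have h2 := congrArg (· ^ 2 ^ ((i : ℕ) + 1)) h1
      simp only [sum_pow_char_pow, mul_pow, ← pow_mul, ← pow_add] at h2
      rw [show (l : ℕ) - i - 1 + (i + 1) = l by omega, zero_pow (by positivity)] at h2
      rw [← h2]
      refine sum_congr rfl fun j _ => ?_
      simp only [of_apply, transpose_apply, pow_mul, pow_succ', pow_zero, mul_one]
  rw [← prod_pow_two_pow, ← mul_assoc, h, ← prod_mul_distrib]
  refine prod_eq_one fun i _ => ?_
  rw [← mul_pow, inv_mul_cancel₀ ha, one_pow]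

theorem moore_mooreDual_ne_zero {m : ℕ} {a : Fin (m + 1) → K} (ha : moore 2 a ≠ 0) :
    moore 2 (mooreDual a) ≠ 0 := by
  intro h
  simpa [h] using moore_mooreDual_sq ha

theorem sum_mul_mooreHat_sq_eq_det_updateRow {m : ℕ} (a x : Fin (m + 1) → K) :
    ∑ j, x j * mooreHat 2 a j ^ 2 =
      ((Matrix.of fun i j : Fin (m + 1) => a j ^ 2 ^ (i : ℕ)).updateRow 0 x).det := by
  conv_rhs => rw [Matrix.det_succ_row _ 0]
  refine sum_congr rfl fun j _ => ?_
  rw [neg_one_pow_char_two, one_mul, mooreHat, ← moore_sq, moore]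
  simp only [updateRow_self]
  congr 2
  ext i l
  simp [Fin.removeNth, pow_mul, pow_succ']

/-- Cramer's rule for the additive polynomial of degree 2^(m+1) vanishing at the a_j. The numerator
of c 0 is (Σ a_j^(2^m) V_j)² = Δ², with V_j the minors of a. -/
theorem exists_frobenius_relation {m : ℕ} {a : Fin (m + 1) → K} (ha : moore 2 a ≠ 0) :
    ∃ c : Fin (m + 1) → K, c 0 = moore 2 a ∧
      ∀ j, a j ^ 2 ^ (m + 1) = ∑ i, c i * a j ^ 2 ^ (i : ℕ) := by
  set M := Matrix.of fun i j : Fin (m + 1) => a j ^ 2 ^ (i : ℕ) with hM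
  set b : Fin (m + 1) → K := fun j => a j ^ 2 ^ (m + 1) with hb
  have hdet : M.det = moore 2 a := rfl
  refine ⟨fun i => Mᵀ.cramer b i / moore 2 a, ?_, fun j => ?_⟩
  · simp only
    rw [cramer_transpose_apply, hM, ← sum_mul_mooreHat_sq_eq_det_updateRow, div_eq_iff ha,
      ← pow_two]
    conv_rhs => rw [← sum_mooreHat_mul_pow, sum_pow_char]
    refine sum_congr rfl fun j _ => ?_
    simp only [hb]
    ring
  · have h := congrFun (Matrix.mulVec_cramer Mᵀ b) j
    rw [det_transpose, hdet, mulVec, dotProduct] at h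
    simp only [div_mul_eq_mul_div, ← sum_div]
    rw [eq_div_iff ha, mul_comm]
    simp only [Pi.smul_apply, smul_eq_mul, transpose_apply, hM, of_apply] at h
    rw [← h]
    exact sum_congr rfl fun i _ => mul_comm _ _

/-- With s_i = Σ f_j g_j^(2^i), the claim reads s₁ = s₁² + βs₀². Orthogonality of f to the powers of
Q gives a two-term recursion for s; the Frobenius relation of g and its square express s_(m+1) and
s_(m+2) in two further ways. Elimination leaves `h6` and `h7`. -/
theorem sum_mooreDual_relation {m : ℕ} {a : Fin (m + 1) → K} (ha : moore 2 a ≠ 0) {β : K}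
    (hβ : β ≠ 0) {Q : Fin (m + 1) → K}
    (hQ : ∀ j, Q j = moore 2 a ^ 2 * (mooreDual a j ^ 4 + β * mooreDual a j ^ 2))
    (hQ0 : moore 2 Q ≠ 0) :
    ∑ j, mooreDual Q j * mooreDual a j ^ 2 =
      ∑ j, mooreDual Q j ^ 2 * (mooreDual a j ^ 4 + β * mooreDual a j ^ 2) := by
  set g := mooreDual a
  set f := mooreDual Q
  set δ := moore 2 a
  set s : ℕ → K := fun i => ∑ j, f j * g j ^ 2 ^ i with hs
  obtain ⟨c, hc0, hc⟩ := exists_frobenius_relation (moore_mooreDual_ne_zero ha)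
  replace hc : ∀ j, g j ^ 2 ^ (m + 1) = ∑ i, c i * g j ^ 2 ^ (i : ℕ) := hc
  have hcδ : c 0 ^ 2 * δ ^ 2 ^ (m + 1) = 1 := by rw [hc0]; exact moore_mooreDual_sq ha
  have hc00 : c 0 ≠ 0 := by rw [hc0]; exact moore_mooreDual_ne_zero ha
  have hrec (i : ℕ) : ∑ j, f j * Q j ^ 2 ^ i =
      δ ^ 2 ^ (i + 1) * (s (i + 2) + β ^ 2 ^ i * s (i + 1)) := by
    simp only [hs, mul_sum, ← sum_add_distrib]
    refine sum_congr rfl fun j _ => ?_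
    rw [hQ, mul_pow, add_pow_char_pow]
    ring
  have h1 : ∀ i < m, s (i + 2) = β ^ 2 ^ i * s (i + 1) := by
    intro i hi
    have := hrec i
    rw [sum_mooreDual_mul_pow_of_lt Q hi, eq_comm, mul_eq_zero] at this
    exact CharTwo.add_eq_zero.mp (this.resolve_left (pow_ne_zero _ ha))
  have h2 : s (m + 2) = β ^ 2 ^ m * s (m + 1) + c 0 ^ 2 := by
    have := hrec m
    rw [sum_mooreDual_mul_pow hQ0, ← hcδ, mul_comm,
      mul_right_inj' (pow_ne_zero _ ha)] at this
    rw [this, add_left_comm, CharTwo.add_self_eq_zero, add_zero]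
  have h3 : ∀ i ≤ m, β * s (i + 1) = β ^ 2 ^ i * s 1 := by
    intro i
    induction i with
    | zero => simp
    | succ i ih =>
      intro hi
      rw [h1 i (by omega), mul_left_comm, ih (by omega)]
      ring
  have h4 : s (m + 1) = c 0 * s 0 + ∑ i : Fin m, c i.succ * s (i + 1) := by
    have : s (m + 1) = ∑ i, c i * s i := by
      simp only [hs, hc, mul_sum]
      rw [sum_comm]
      exact sum_congr rfl fun i _ => sum_congr rfl fun j _ => by ring
    rw [this, Fin.sum_univ_succ]
    simp
  have h5 : s (m + 2) = c 0 ^ 2 * s 1 + ∑ i : Fin m, c i.succ ^ 2 * s (i + 2) := by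
    have : s (m + 2) = ∑ i : Fin (m + 1), c i ^ 2 * s (i + 1) := by
      simp only [hs, pow_succ 2 (m + 1), pow_mul _ (2 ^ (m + 1)) 2, hc, mul_sum, sum_pow_char]
      rw [sum_comm]
      refine sum_congr rfl fun i _ => sum_congr rfl fun j _ => ?_
      ring
    rw [this, Fin.sum_univ_succ]
    simp
  have h9 : s 1 = ∑ j, f j * g j ^ 2 := by simp [hs]
  have h10 : s 0 = ∑ j, f j * g j := by simp [hs]
  clear_value s
  set G := β ^ 2 ^ m + ∑ i : Fin m, c i.succ * β ^ 2 ^ (i : ℕ) with hG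
  have hG2 : G ^ 2 = β ^ 2 ^ (m + 1) + ∑ i : Fin m, c i.succ ^ 2 * β ^ 2 ^ ((i : ℕ) + 1) := by
    rw [hG, CharTwo.add_sq, sum_pow_char]
    congr 1
    · ring
    · exact sum_congr rfl fun j _ => by ring
  have h6 : β * (c 0 * s 0) = s 1 * G := by
    have e1 : β * s (m + 1) = β * (c 0 * s 0) + ∑ i : Fin m, c i.succ * β ^ 2 ^ (i : ℕ) * s 1 := by
      rw [h4, mul_add, mul_sum]
      congr 1
      refine sum_congr rfl fun i _ => ?_
      rw [mul_left_comm, h3 i i.2.le, mul_assoc]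
    rw [h3 m le_rfl, ← sum_mul] at e1
    rw [hG, mul_add, mul_comm, mul_comm (s 1) (∑ i, _), ← mul_comm (β ^ 2 ^ m), e1, add_assoc,
      CharTwo.add_self_eq_zero, add_zero, mul_comm]
  have h7 : s 1 * (c 0 ^ 2 * β + G ^ 2) = β * c 0 ^ 2 := by
    have e1 : β * s (m + 2) = β * (c 0 ^ 2 * s 1) +
        ∑ i : Fin m, c i.succ ^ 2 * β ^ 2 ^ ((i : ℕ) + 1) * s 1 := by
      rw [h5, mul_add, mul_sum]
      congr 1
      refine sum_congr rfl fun i _ => ?_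
      rw [mul_left_comm, h3 (i + 1) i.2, mul_assoc]
    have e2 : β * s (m + 2) = β ^ 2 ^ (m + 1) * s 1 + β * c 0 ^ 2 := by
      rw [h2, mul_add, mul_left_comm, h3 m le_rfl]
      ring
    rw [← sum_mul] at e1
    rw [hG2]
    have := CharTwo.two_eq_zero (R := K)
    linear_combination e2 - e1 + (s 1 * β ^ 2 ^ (m + 1)) * this
  have h8 : s 1 = s 1 ^ 2 + β * s 0 ^ 2 := by
    -- After multiplication by c₀²β, this is s₁ times `h7`, with (s₁G)² replaced by means of `h6`.
    refine mul_left_cancel₀ (mul_ne_zero (pow_ne_zero 2 hc00) hβ) ?_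
    linear_combination (-s 1) * h7 - (β * (c 0 * s 0) + s 1 * G) * h6
  rw [← h9, h8, h9, h10, sum_pow_char, sum_pow_char, mul_sum, ← sum_add_distrib]
  exact sum_congr rfl fun j _ => by ring

/-- Differentiating the orthogonality relations gives a linear system for the D f_j, with the Moore
matrix of Q. The f_j² x solve the same system: the row i = 0 is the hypothesis, the others are
squared relations. -/
theorem derivation_mooreDual {k M : Type*} [Field k] [Algebra k K] [AddCommGroup M] [Module k M]
    [Module K M] (D : Derivation k K M) (x : M) {m : ℕ} {Q : Fin (m + 1) → K}
    (hQ : moore 2 Q ≠ 0)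
    (h : ∑ j, mooreDual Q j • D (Q j) = (∑ j, mooreDual Q j ^ 2 * Q j) • x) (l : Fin (m + 1)) :
    D (mooreDual Q l) = mooreDual Q l ^ 2 • x := by
  set f := mooreDual Q
  set y : Fin (m + 1) → M := fun j => D (f j) - f j ^ 2 • x with hy
  have htwo (z : M) : z + z = 0 := by
    rw [← two_smul K, CharTwo.two_eq_zero, zero_smul]
  have hconst (i : ℕ) (hi : i ≤ m) : D (∑ j, f j * Q j ^ 2 ^ i) = 0 := by
    rcases hi.lt_or_eq with hi | rfl
    · rw [sum_mooreDual_mul_pow_of_lt Q hi, map_zero]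
    · rw [sum_mooreDual_mul_pow hQ, D.map_one_eq_zero]
  have hrow (i : ℕ) (hi : i ≤ m) : ∑ j, Q j ^ 2 ^ i • y j = 0 := by
    have h1 := hconst i hi
    simp only [map_sum, Derivation.leibniz, sum_add_distrib] at h1
    rcases i with _ | i
    · simp only [pow_zero, pow_one] at h1
      simp only [hy, pow_zero, pow_one, smul_sub, sum_sub_distrib, smul_smul]
      rw [eq_neg_of_add_eq_zero_right h1, h, ← sum_smul, sub_eq_zero, neg_eq_iff_add_eq_zero,
        ← add_smul]
      simp only [mul_comm, CharTwo.add_self_eq_zero, zero_smul]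
    · have h2 (j : Fin (m + 1)) : D (Q j ^ 2 ^ (i + 1)) = 0 := by
        rw [Derivation.leibniz_pow, pow_succ, mul_smul, two_nsmul, htwo, smul_zero]
      simp only [h2, smul_zero, sum_const_zero, zero_add] at h1
      simp only [hy, smul_sub, sum_sub_distrib, smul_smul]
      rw [h1, ← sum_smul]
      have h3 := congrArg (· ^ 2) (sum_mooreDual_mul_pow_of_lt Q (i := i) (by omega))
      simp only [sum_pow_char, mul_pow, ← pow_mul, ← pow_succ] at h3
      have h4 : ∑ j, Q j ^ 2 ^ (i + 1) * f j ^ 2 = 0 := by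
        rw [← zero_pow (two_ne_zero), ← h3]
        exact sum_congr rfl fun j _ => mul_comm _ _
      rw [h4, zero_smul, sub_zero]
  have hu : IsUnit (Matrix.of fun i j : Fin (m + 1) => Q j ^ 2 ^ (i : ℕ)).det :=
    isUnit_iff_ne_zero.mpr hQ
  set A := Matrix.of fun i j : Fin (m + 1) => Q j ^ 2 ^ (i : ℕ) with hA
  have hl : y l = 0 := by
    have h1 : ∑ i, A⁻¹ l i • ∑ j, A i j • y j = y l := by
      simp only [smul_sum, smul_smul]
      rw [sum_comm]
      simp only [← sum_smul]
      have h2 (j : Fin (m + 1)) : ∑ i, A⁻¹ l i * A i j = (1 : Matrix _ _ K) l j := by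
        rw [← Matrix.nonsing_inv_mul A hu, mul_apply]
      simp [h2, Matrix.one_apply]
    rw [← h1]
    refine sum_eq_zero fun i _ => ?_
    have := hrow i (Nat.lt_succ_iff.mp i.2)
    simp only [hA, of_apply]
    rw [this, smul_zero]
  exact sub_eq_zero.mp hl

end MooreDual

/-! ### Degrees and leading coefficients of Moore determinants of polynomials. -/

section Degrees

open Finset

variable {R : Type*} [CommRing R]

theorem coeff_prod_sum_of_natDegree_le {ι : Type*} (s : Finset ι) (f : ι → R[X]) (d : ι → ℕ)
    (h : ∀ i ∈ s, (f i).natDegree ≤ d i) :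
    (∏ i ∈ s, f i).coeff (∑ i ∈ s, d i) = ∏ i ∈ s, (f i).coeff (d i) := by
  classical
  induction s using Finset.induction_on with
  | empty => simp
  | insert a s ha ih =>
    have hs : ∀ i ∈ s, (f i).natDegree ≤ d i := fun i hi => h i (mem_insert_of_mem hi)
    rw [prod_insert ha, sum_insert ha, prod_insert ha, coeff_mul_add_eq_of_natDegree_le
      (h a (mem_insert_self _ _)) ((natDegree_prod_le _ _).trans (sum_le_sum hs)), ih hs]

theorem sum_two_pow_mul (n l : ℕ) : ∑ i : Fin n, 2 ^ (i : ℕ) * l = l * (2 ^ n - 1) := by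
  rw [← sum_mul, Fin.sum_univ_eq_sum_range (fun i => 2 ^ i) n, Nat.geomSum_eq le_rfl]
  simp [mul_comm]

theorem natDegree_moore_le {n l : ℕ} {A : Fin n → R[X]} (h : ∀ j, (A j).natDegree ≤ l) :
    (moore 2 A).natDegree ≤ l * (2 ^ n - 1) := by
  rw [moore, Matrix.det_apply]
  refine natDegree_sum_le_of_forall_le _ _ fun σ _ => (natDegree_smul_le _ _).trans ?_
  refine (natDegree_prod_le _ _).trans ?_
  rw [← sum_two_pow_mul, ← Equiv.sum_comp σ (fun i : Fin n => 2 ^ (i : ℕ) * l)]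
  refine sum_le_sum fun i _ => ?_
  exact natDegree_pow_le_of_le _ (h i)

theorem coeff_moore {n l : ℕ} {A : Fin n → R[X]} (h : ∀ j, (A j).natDegree ≤ l) :
    (moore 2 A).coeff (l * (2 ^ n - 1)) = moore 2 fun j => (A j).coeff l := by
  rw [moore, moore, Matrix.det_apply, Matrix.det_apply, finsetSum_coeff]
  refine sum_congr rfl fun σ _ => ?_
  rw [coeff_smul]
  congr 1
  rw [← sum_two_pow_mul, ← Equiv.sum_comp σ (fun i : Fin n => 2 ^ (i : ℕ) * l)]
  simp only [Matrix.of_apply]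
  rw [coeff_prod_sum_of_natDegree_le]
  · exact prod_congr rfl fun i _ => coeff_pow_of_natDegree_le (h i)
  · exact fun i _ => natDegree_pow_le_of_le _ (h i)

theorem natDegree_moore {n l : ℕ} {A : Fin n → R[X]} (h : ∀ j, (A j).natDegree ≤ l)
    (h0 : (moore 2 fun j => (A j).coeff l) ≠ 0) : (moore 2 A).natDegree = l * (2 ^ n - 1) :=
  natDegree_eq_of_le_of_coeff_ne_zero (natDegree_moore_le h) (by rwa [coeff_moore h])

theorem natDegree_mooreHat {m l : ℕ} {A : Fin (m + 1) → R[X]} (h : ∀ j, (A j).natDegree ≤ l)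
    {i : Fin (m + 1)} (h0 : mooreHat 2 (fun j => (A j).coeff l) i ≠ 0) :
    (mooreHat 2 A i).natDegree = l * (2 ^ m - 1) :=
  natDegree_moore (A := i.removeNth A) (fun _ => h _) h0

theorem leadingCoeff_mooreHat {m l : ℕ} {A : Fin (m + 1) → R[X]} (h : ∀ j, (A j).natDegree ≤ l)
    {i : Fin (m + 1)} (h0 : mooreHat 2 (fun j => (A j).coeff l) i ≠ 0) :
    (mooreHat 2 A i).leadingCoeff = mooreHat 2 (fun j => (A j).coeff l) i := by
  rw [leadingCoeff, natDegree_mooreHat h h0]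
  exact coeff_moore (A := i.removeNth A) fun _ => h _

theorem mooreHat_ne_zero_of_moore_ne_zero [IsDomain R] [CharP R 2] [Algebra (ZMod 2) R] {m : ℕ}
    {a : Fin (m + 1) → R} (h : moore 2 a ≠ 0) (i : Fin (m + 1)) : mooreHat 2 a i ≠ 0 :=
  moore_ne_zero_of_linearIndependent
    ((linearIndependent_of_moore_ne_zero h).comp _ Fin.succAbove_right_injective)

end Degrees

/-! ### Logarithmic forms on the projective line and their divisors. -/

section LogarithmicForms

open Finset

variable {k : Type*} [Field k]

/-- Localization is formally étale, so dX in k(X) comes from dX in k[X], which corresponds to 1 in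
k[X]. -/
theorem D_ratFunc_X_ne_zero : KaehlerDifferential.D k (RatFunc k) RatFunc.X ≠ 0 := by
  have : Algebra.FormallyEtale k[X] (RatFunc k) :=
    Algebra.FormallyEtale.of_isLocalization (nonZeroDivisors k[X])
  intro h
  have h1 := KaehlerDifferential.tensorKaehlerEquivOfFormallyEtale_symm_D_algebraMap
    k k[X] (RatFunc k) X
  rw [RatFunc.algebraMap_X, h, map_zero] at h1
  have h2 := congrArg (TensorProduct.lift ((LinearMap.lsmul k[X] (RatFunc k)).flip.compl₂
    (KaehlerDifferential.polynomialEquiv k).toLinearMap)) h1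
  simp at h2

theorem dForm_eq_zero_iff {f : RatFunc k} : dForm f = 0 ↔ f = 0 := by
  rw [dForm, smul_eq_zero]
  simp [D_ratFunc_X_ne_zero]

theorem dForm_sum_smul [Algebra (ZMod 2) k] {ι : Type*} [Fintype ι] (e : ι → ZMod 2)
    (f : ι → RatFunc k) :
    dForm (∑ i, e i • f i) = ∑ i, e i • dForm (f i) := by
  simp only [dForm, sum_smul]
  refine sum_congr rfl fun i _ => ?_
  by_cases h : e i = 0
  · simp [h]
  · simp [zmod_two_eq_one h]

theorem isLogarithmic_dForm {f : RatFunc k} (hf : f ≠ 0)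
    (h : KaehlerDifferential.D k (RatFunc k) f = dForm (f ^ 2)) : IsLogarithmic (dForm f) := by
  refine ⟨f, hf, ?_⟩
  rw [h, dForm, dForm, smul_smul]
  congr 1
  field_simp

theorem hasOnlyZeroAtInfty_inv {P : k[X]} {r : ℤ} (hr : (P.natDegree : ℤ) - 2 = r) :
    HasOnlyZeroAtInfty (dForm (algebraMap k[X] (RatFunc k) P)⁻¹) r := by
  refine ⟨_, rfl, fun a => ?_, ?_⟩
  · by_cases hP : P = 0
    · simp [hP, ordAt]
    have h1 : ((algebraMap k[X] (RatFunc k) P)⁻¹).num ∣ 1 := by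
      have := RatFunc.num_div_dvd (1 : k[X]) hP
      rwa [map_one, one_div] at this
    have h2 : ((algebraMap k[X] (RatFunc k) P)⁻¹).num.rootMultiplicity a = 0 := by
      refine rootMultiplicity_eq_zero fun h => ?_
      have := (dvd_iff_isRoot.mpr h).trans h1
      exact not_isUnit_X_sub_C a (isUnit_of_dvd_one this)
    simp [ordAt, h2]
  · rw [RatFunc.intDegree_inv, RatFunc.intDegree_polynomial, neg_neg, hr]

/-- One summand has odd degree and the other even degree (as `natDegree`), so leading terms cannot
cancel. -/
theorem two_mul_natDegree_lt_natDegree {Δ γ : k[X]} (hΔ : Δ ≠ 0) :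
    2 * Δ.natDegree < (X * Δ ^ 2 + γ ^ 2).natDegree := by
  have h1 : (X * Δ ^ 2).natDegree = 2 * Δ.natDegree + 1 := by
    rw [natDegree_X_mul (pow_ne_zero _ hΔ), natDegree_pow]
  have h2 : (γ ^ 2).natDegree = 2 * γ.natDegree := natDegree_pow _ _
  rcases lt_or_ge (γ ^ 2).natDegree (X * Δ ^ 2).natDegree with h | h
  · rw [natDegree_add_eq_left_of_natDegree_lt h]
    omega
  · rw [natDegree_add_eq_right_of_natDegree_lt (by omega)]
    omega

variable [CharP k 2]

instance ratFunc_charP_two : CharP (RatFunc k) 2 :=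
  charP_of_injective_algebraMap (algebraMap k (RatFunc k)).injective 2

theorem omegaOf_eq_dForm {m : ℕ} (Q : Fin (m + 1) → k[X]) (i : Fin (m + 1)) :
    omegaOf 2 Q i = dForm (mooreDual (fun j => algebraMap k[X] (RatFunc k) (Q j)) i) := by
  rw [omegaOf, mooreDual, neg_one_pow_char_two, one_mul, moore_map, mooreHat_map]

theorem D_ratFunc_sq (f : RatFunc k) : KaehlerDifferential.D k (RatFunc k) (f ^ 2) = 0 := by
  rw [Derivation.leibniz_pow, ← Nat.cast_smul_eq_nsmul (RatFunc k), Nat.cast_ofNat,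
    CharTwo.two_eq_zero, zero_smul]

theorem X_add_sq_ne_zero (α : RatFunc k) : RatFunc.X + α ^ 2 ≠ 0 := by
  intro h
  have := congrArg (KaehlerDifferential.D k (RatFunc k)) h
  rw [map_add, D_ratFunc_sq, add_zero, map_zero] at this
  exact D_ratFunc_X_ne_zero this

/-- Everything in Q_j except X·V_j² is a square, hence killed by d. -/
theorem D_ratQ {m : ℕ} (W : Fin (m + 1) → k[X]) (α : RatFunc k) (j : Fin (m + 1)) :
    KaehlerDifferential.D k (RatFunc k) (ratQ W α j) =
      dForm (algebraMap k[X] (RatFunc k) (mooreHat 2 W j) ^ 2) := by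
  have h : ratQ W α j = (algebraMap k[X] (RatFunc k) (mooreHat 2 W j) ^ 2 /
      algebraMap k[X] (RatFunc k) (moore 2 W)) ^ 2 +
      (algebraMap k[X] (RatFunc k) (mooreHat 2 W j) ^ 2 * RatFunc.X +
      (α * algebraMap k[X] (RatFunc k) (mooreHat 2 W j)) ^ 2) := by
    rw [ratQ]
    ring
  rw [h, map_add, map_add, D_ratFunc_sq, D_ratFunc_sq, zero_add, add_zero, Derivation.leibniz,
    D_ratFunc_sq, smul_zero, add_zero, dForm]

theorem D_mooreDual_ratQ {m : ℕ} {W : Fin (m + 1) → k[X]} (hW : moore 2 W ≠ 0) {α : RatFunc k}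
    (hQ : moore 2 (ratQ W α) ≠ 0) (i : Fin (m + 1)) :
    KaehlerDifferential.D k (RatFunc k) (mooreDual (ratQ W α) i) =
      dForm (mooreDual (ratQ W α) i ^ 2) := by
  set w : Fin (m + 1) → RatFunc k := fun j => algebraMap k[X] (RatFunc k) (W j)
  have hm : moore 2 w = algebraMap k[X] (RatFunc k) (moore 2 W) := moore_map _ _
  have hw : moore 2 w ≠ 0 := by
    rw [hm]
    simpa using hW
  have hV (j : Fin (m + 1)) : algebraMap k[X] (RatFunc k) (mooreHat 2 W j) =
      moore 2 w * mooreDual w j := by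
    rw [mooreDual, mul_div_cancel₀ _ hw]
    exact (mooreHat_map _ _ j).symm
  have hr (j : Fin (m + 1)) : ratQ W α j =
      moore 2 w ^ 2 * (mooreDual w j ^ 4 + (RatFunc.X + α ^ 2) * mooreDual w j ^ 2) := by
    rw [ratQ, ← hm, hV]
    field_simp
  refine derivation_mooreDual _ _ hQ ?_ i
  simp only [D_ratQ, dForm, smul_smul, ← sum_smul]
  congr 1
  have h := congrArg (moore 2 w ^ 2 * ·)
    (sum_mooreDual_relation hw (X_add_sq_ne_zero α) hr hQ)
  simp only [mul_sum] at h
  convert h using 1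
  · refine sum_congr rfl fun j _ => ?_
    rw [hV]
    ring
  · refine sum_congr rfl fun j _ => ?_
    rw [mul_left_comm, ← hr]

variable [Algebra (ZMod 2) k]

theorem derivation_sum_smul {ι : Type*} [Fintype ι] (e : ι → ZMod 2) (f : ι → RatFunc k)
    (h : ∀ i, KaehlerDifferential.D k (RatFunc k) (f i) = dForm (f i ^ 2)) :
    KaehlerDifferential.D k (RatFunc k) (∑ i, e i • f i) = dForm ((∑ i, e i • f i) ^ 2) := by
  simp only [map_sum, sum_pow_char, dForm, sum_smul]
  refine sum_congr rfl fun i _ => ?_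
  by_cases hi : e i = 0
  · simp [hi]
  · rw [zmod_two_eq_one hi, one_smul]
    exact h i

/-- After a shear the combination is one minor over the full determinant, and that minor divides the
determinant. -/
theorem exists_sum_smul_mooreDual_eq_inv {m l : ℕ} {Q : Fin (m + 1) → k[X]}
    (hdeg : ∀ i, (Q i).natDegree = l) (hlc : moore 2 (fun i => (Q i).leadingCoeff) ≠ 0)
    {e : Fin (m + 1) → ZMod 2} (he : e ≠ 0) :
    ∃ P : k[X], P ≠ 0 ∧ P.natDegree = l * 2 ^ m ∧
      ∑ i, e i • mooreDual (fun j => algebraMap k[X] (RatFunc k) (Q j)) i =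
        (algebraMap k[X] (RatFunc k) P)⁻¹ := by
  obtain ⟨i₀, h₀⟩ := exists_eq_one_of_ne_zero he
  have hlc' : moore 2 (fun i => (Q i).coeff l) ≠ 0 := by
    simpa only [leadingCoeff, hdeg] using hlc
  have hle : ∀ j, (shear Q e i₀ j).natDegree ≤ l := fun j =>
    natDegree_add_le_of_degree_le (hdeg j).le ((natDegree_smul_le _ _).trans (hdeg i₀).le)
  have hco : (fun j => (shear Q e i₀ j).coeff l) = shear (fun j => (Q j).coeff l) e i₀ := by
    ext j; simp [shear]
  have hu0 : mooreHat 2 (fun j => (shear Q e i₀ j).coeff l) i₀ ≠ 0 := by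
    rw [hco]
    refine mooreHat_ne_zero_of_moore_ne_zero ?_ i₀
    rwa [moore_shear]
  have hu := natDegree_mooreHat hle hu0
  have hune : mooreHat 2 (shear Q e i₀) i₀ ≠ 0 := by
    intro h
    apply hu0
    rw [← leadingCoeff_mooreHat hle hu0, h, leadingCoeff_zero]
  have hΔ := natDegree_moore (fun j => (hdeg j).le) hlc'
  have hΔ0 : moore 2 Q ≠ 0 := by
    intro h
    apply hlc'
    rw [← coeff_moore (fun j => (hdeg j).le), h, coeff_zero]
  obtain ⟨P, hP⟩ := mooreHat_dvd_moore _ i₀ hune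
  rw [moore_shear] at hP
  have hP0 : P ≠ 0 := by
    rintro rfl
    exact hΔ0 (by rw [hP, mul_zero])
  refine ⟨P, hP0, ?_, ?_⟩
  · have h1 := congrArg natDegree hP
    rw [natDegree_mul hune hP0, hu, hΔ] at h1
    have h2 : l * (2 ^ (m + 1) - 1) = l * (2 ^ m - 1) + l * 2 ^ m := by
      rw [← mul_add]
      congr 1
      have := Nat.one_le_two_pow (n := m)
      omega
    omega
  · have h1 : ∑ i, e i • mooreDual (fun j => algebraMap k[X] (RatFunc k) (Q j)) i =
        algebraMap k[X] (RatFunc k) (∑ i, e i • mooreHat 2 Q i) /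
          algebraMap k[X] (RatFunc k) (moore 2 Q) := by
      rw [map_sum, sum_div]
      refine sum_congr rfl fun i _ => ?_
      rw [mooreDual, moore_map, mooreHat_map]
      by_cases h : e i = 0
      · simp [h]
      · simp [zmod_two_eq_one h]
    rw [h1, sum_smul_mooreHat Q e h₀, hP, map_mul]
    have h2 : algebraMap k[X] (RatFunc k) (mooreHat 2 (shear Q e i₀) i₀) ≠ 0 := by
      simpa using hune
    field_simp

theorem givesRiseToSpaceL_of_derivation {m l : ℕ} (hm : 1 ≤ m) (hl : 1 ≤ l)
    {Q : Fin (m + 1) → k[X]} (hdeg : ∀ i, (Q i).natDegree = l)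
    (hlc : moore 2 (fun i => (Q i).leadingCoeff) ≠ 0)
    (hD : ∀ i, KaehlerDifferential.D k (RatFunc k)
      (mooreDual (fun j => algebraMap k[X] (RatFunc k) (Q j)) i) =
        dForm (mooreDual (fun j => algebraMap k[X] (RatFunc k) (Q j)) i ^ 2)) :
    GivesRiseToSpaceL 2 l Q := by
  set f := mooreDual (fun j => algebraMap k[X] (RatFunc k) (Q j)) with hf
  have hom : omegaOf 2 Q = fun i => dForm (f i) := funext fun i => omegaOf_eq_dForm Q i
  have hli : LinearIndependent (ZMod 2) (omegaOf 2 Q) := by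
    rw [Fintype.linearIndependent_iff]
    intro e he
    by_contra hne
    obtain ⟨P, hP0, -, hP⟩ := exists_sum_smul_mooreDual_eq_inv hdeg hlc (e := e)
      fun h => hne (by simp [h])
    simp only [hom] at he
    rw [← dForm_sum_smul, dForm_eq_zero_iff, hP] at he
    simp [hP0] at he
  have hmem : ∀ ω ∈ Submodule.span (ZMod 2) (Set.range (omegaOf 2 Q)), ω ≠ 0 →
      ∃ e : Fin (m + 1) → ZMod 2, e ≠ 0 ∧ ω = dForm (∑ i, e i • f i) := by
    intro ω hω h0
    obtain ⟨e, rfl⟩ := (Submodule.mem_span_range_iff_exists_fun (ZMod 2)).mp hω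
    refine ⟨e, ?_, ?_⟩
    · rintro rfl
      simp at h0
    · rw [dForm_sum_smul, hom]
  refine ⟨hl, hdeg, hlc, hli, ?_, by omega, ?_, ?_, ?_⟩
  -- The bound 2 ≤ l·2^m uses m ≥ 1.
  · have : 2 ^ 1 ≤ 2 ^ (m + 1 - 1) := Nat.pow_le_pow_right (by norm_num) (by omega)
    nlinarith
  · rw [finrank_span_eq_card hli, Fintype.card_fin]
  · intro ω hω h0
    obtain ⟨e, -, rfl⟩ := hmem ω hω h0
    refine isLogarithmic_dForm (fun h => h0 (by rw [h]; simp [dForm])) ?_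
    exact derivation_sum_smul e f hD
  · intro ω hω h0
    obtain ⟨e, he, rfl⟩ := hmem ω hω h0
    obtain ⟨P, -, hPd, hP⟩ := exists_sum_smul_mooreDual_eq_inv hdeg hlc he
    rw [hf, hP]
    refine hasOnlyZeroAtInfty_inv ?_
    rw [hPd]
    simp

end LogarithmicForms

/-! ### Integrality of the Q_i implies admissibility. -/

section Admissible

open Finset

variable {k : Type*} [Field k] [CharP k 2] [Algebra (ZMod 2) k]

/-- In Q_i Δ² = V_i⁴ + H V_i² with H = XΔ² + γ², the second term dominates. Hence the Q_i share one
degree, and their leading coefficients are a common constant times the v_i², whose Moore determinant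
is nonzero by duality. -/
theorem isAdmissible_of_polynomial {m d : ℕ} (hm : 1 ≤ m) {W : Fin (m + 1) → k[X]}
    (hdeg : ∀ j, (W j).natDegree ≤ d) (hlc : moore 2 (fun j => (W j).coeff d) ≠ 0) (γ : k[X])
    {Q : Fin (m + 1) → k[X]}
    (hQ : ∀ i, algebraMap k[X] (RatFunc k) (Q i) = ratQ W
      (algebraMap k[X] (RatFunc k) γ / algebraMap k[X] (RatFunc k) (moore 2 W)) i) :
    IsAdmissible W
      (algebraMap k[X] (RatFunc k) γ / algebraMap k[X] (RatFunc k) (moore 2 W)) := by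
  set Δ := moore 2 W with hΔdef
  set V : Fin (m + 1) → k[X] := fun i => mooreHat 2 W i with hV
  set v : Fin (m + 1) → k := fun i => mooreHat 2 (fun j => (W j).coeff d) i with hv
  have hv0 (i : Fin (m + 1)) : v i ≠ 0 := mooreHat_ne_zero_of_moore_ne_zero hlc i
  have hVd (i : Fin (m + 1)) : (V i).natDegree = d * (2 ^ m - 1) := natDegree_mooreHat hdeg (hv0 i)
  have hVl (i : Fin (m + 1)) : (V i).leadingCoeff = v i := leadingCoeff_mooreHat hdeg (hv0 i)
  have hΔd : Δ.natDegree = d * (2 ^ (m + 1) - 1) := natDegree_moore hdeg hlc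
  have hΔ0 : Δ ≠ 0 := by
    intro h
    apply hlc
    rw [← coeff_moore hdeg, ← hΔdef, h, coeff_zero]
  have hEd : Δ.natDegree = 2 * (d * (2 ^ m - 1)) + d := by
    rw [hΔd]
    obtain ⟨t, ht⟩ := Nat.exists_eq_add_of_le' (Nat.one_le_two_pow (n := m))
    rw [pow_succ, ht, show (t + 1) * 2 - 1 = 2 * t + 1 by omega, Nat.add_sub_cancel]
    ring
  set H := X * Δ ^ 2 + γ ^ 2 with hH
  have hHd : 2 * Δ.natDegree < H.natDegree := two_mul_natDegree_lt_natDegree hΔ0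
  have hH0 : H ≠ 0 := by
    intro h
    simp [h] at hHd
  have hkey (i : Fin (m + 1)) : Q i * Δ ^ 2 = V i ^ 4 + H * V i ^ 2 := by
    apply IsFractionRing.injective k[X] (RatFunc k)
    have h1 : algebraMap k[X] (RatFunc k) Δ ≠ 0 := by simpa using hΔ0
    simp only [map_mul, map_add, map_pow, hH, hQ, ratQ, RatFunc.algebraMap_X, hV, ← hΔdef]
    field_simp
  have hV0 (i : Fin (m + 1)) : V i ≠ 0 := by
    intro h
    apply hv0 i
    rw [← hVl, h, leadingCoeff_zero]
  have hHV (i : Fin (m + 1)) : (H * V i ^ 2).natDegree = H.natDegree + 2 * (d * (2 ^ m - 1)) := by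
    rw [natDegree_mul hH0 (pow_ne_zero _ (hV0 i)), natDegree_pow, hVd]
  have hlt (i : Fin (m + 1)) : (V i ^ 4).natDegree < (H * V i ^ 2).natDegree := by
    rw [hHV, natDegree_pow, hVd]
    omega
  have hQ0 (i : Fin (m + 1)) : Q i ≠ 0 := by
    intro h
    have h1 := congrArg natDegree (hkey i)
    rw [natDegree_add_eq_right_of_natDegree_lt (hlt i), h, zero_mul, natDegree_zero] at h1
    have := hlt i
    omega
  have hQd (i : Fin (m + 1)) :
      (Q i).natDegree = H.natDegree + 2 * (d * (2 ^ m - 1)) - 2 * Δ.natDegree := by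
    have h1 := congrArg natDegree (hkey i)
    rw [natDegree_add_eq_right_of_natDegree_lt (hlt i), hHV,
      natDegree_mul (hQ0 i) (pow_ne_zero _ hΔ0), natDegree_pow] at h1
    omega
  have hQl (i : Fin (m + 1)) :
      (Q i).leadingCoeff = H.leadingCoeff / Δ.leadingCoeff ^ 2 * v i ^ 2 := by
    have h1 := congrArg leadingCoeff (hkey i)
    rw [leadingCoeff_add_of_degree_lt (degree_lt_degree (hlt i)), leadingCoeff_mul,
      leadingCoeff_mul, leadingCoeff_pow, leadingCoeff_pow, hVl] at h1
    have h2 : Δ.leadingCoeff ≠ 0 := leadingCoeff_ne_zero.mpr hΔ0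
    field_simp
    exact h1
  have hmv : moore 2 v ≠ 0 := by
    have h1 : v = fun j => moore 2 (fun j => (W j).coeff d) *
        mooreDual (fun j => (W j).coeff d) j := by
      ext j
      rw [mooreDual, mul_div_cancel₀ _ hlc]
    rw [h1, moore_mul_left]
    exact mul_ne_zero (prod_ne_zero_iff.mpr fun _ _ => pow_ne_zero _ hlc)
      (moore_mooreDual_ne_zero hlc)
  have hlcQ : moore 2 (fun i => (Q i).leadingCoeff) ≠ 0 := by
    simp only [hQl]
    rw [moore_mul_left, moore_sq]
    refine mul_ne_zero (prod_ne_zero_iff.mpr fun _ _ => pow_ne_zero _ ?_) (pow_ne_zero _ hmv)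
    exact div_ne_zero (leadingCoeff_ne_zero.mpr hH0)
      (pow_ne_zero _ (leadingCoeff_ne_zero.mpr hΔ0))
  refine ⟨Q, hQ, _, givesRiseToSpaceL_of_derivation hm ?_ hQd hlcQ fun i => ?_⟩
  · have := hlt 0
    omega
  · rw [funext hQ]
    refine D_mooreDual_ratQ hΔ0 ?_ i
    rw [← funext hQ, moore_map]
    have h1 : moore 2 Q ≠ 0 := by
      intro h
      apply hlcQ
      simp only [leadingCoeff, hQd]
      rw [← coeff_moore (fun j => (hQd j).le), h, coeff_zero]
    simpa using h1

end Admissible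

/-! ### Arithmetic of a span of pairwise coprime polynomials. -/

section CoprimeSpan

open Finset

variable {k : Type*} [Field k] [Algebra (ZMod 2) k] {m d : ℕ}
  {W : Fin (m + 1) → k[X]}

theorem sum_smul_mem_span {ι M : Type*} [Fintype ι] [AddCommGroup M] [Module (ZMod 2) M]
    (W : ι → M) (e : ι → ZMod 2) :
    ∑ j, e j • W j ∈ Submodule.span (ZMod 2) (Set.range W) :=
  (Submodule.mem_span_range_iff_exists_fun (ZMod 2)).mpr ⟨e, rfl⟩

theorem sum_smul_ne_zero {ι M : Type*} [Fintype ι] [AddCommGroup M] [Module (ZMod 2) M]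
    {W : ι → M} (hW : LinearIndependent (ZMod 2) W) {e : ι → ZMod 2} (he : e ≠ 0) :
    ∑ j, e j • W j ≠ 0 := fun h =>
  he (injective_sum_smul hW (by simpa using h))

theorem natDegree_eq_of_span (hW : LinearIndependent (ZMod 2) W)
    (hdeg : ∀ A ∈ Submodule.span (ZMod 2) (Set.range W), A ≠ 0 → A.natDegree = d)
    (j : Fin (m + 1)) : (W j).natDegree = d :=
  hdeg _ (Submodule.subset_span ⟨j, rfl⟩) (hW.ne_zero j)

theorem isCoprime_sum_smul (hW : LinearIndependent (ZMod 2) W)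
    (hcop : ∀ A ∈ Submodule.span (ZMod 2) (Set.range W),
      ∀ B ∈ Submodule.span (ZMod 2) (Set.range W), A ≠ 0 → B ≠ 0 → A ≠ B → IsCoprime A B)
    {e e' : Fin (m + 1) → ZMod 2} (he : e ≠ 0) (he' : e' ≠ 0) (h : e ≠ e') :
    IsCoprime (∑ j, e j • W j) (∑ j, e' j • W j) :=
  hcop _ (sum_smul_mem_span W e) _ (sum_smul_mem_span W e') (sum_smul_ne_zero hW he)
    (sum_smul_ne_zero hW he') fun h' => h (injective_sum_smul hW h')

variable [CharP k 2]

theorem moore_coeff_ne_zero (hW : LinearIndependent (ZMod 2) W)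
    (hdeg : ∀ A ∈ Submodule.span (ZMod 2) (Set.range W), A ≠ 0 → A.natDegree = d) :
    moore 2 (fun j => (W j).coeff d) ≠ 0 := by
  refine moore_ne_zero_of_linearIndependent (Fintype.linearIndependent_iff.mpr fun e he => ?_)
  by_contra hne
  have h0 := sum_smul_ne_zero hW (e := e) fun h => hne (by simp [h])
  have h1 := hdeg _ (sum_smul_mem_span W e) h0
  apply h0
  rw [← leadingCoeff_eq_zero, leadingCoeff, h1, finsetSum_coeff]
  simpa using he

theorem moore_ne_zero_of_span (hW : LinearIndependent (ZMod 2) W)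
    (hdeg : ∀ A ∈ Submodule.span (ZMod 2) (Set.range W), A ≠ 0 → A.natDegree = d) :
    moore 2 W ≠ 0 := by
  intro h
  apply moore_coeff_ne_zero hW hdeg
  rw [← coeff_moore fun j => (natDegree_eq_of_span hW hdeg j).le, h, coeff_zero]

/-- The Moore determinant of `W` divides every polynomial divisible by all the nonzero elements of
the `𝔽₂`-span of `W`. -/
theorem moore_dvd_of_forall_sum_smul_dvd (hW : LinearIndependent (ZMod 2) W)
    (hdeg : ∀ A ∈ Submodule.span (ZMod 2) (Set.range W), A ≠ 0 → A.natDegree = d)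
    (hcop : ∀ A ∈ Submodule.span (ZMod 2) (Set.range W),
      ∀ B ∈ Submodule.span (ZMod 2) (Set.range W), A ≠ 0 → B ≠ 0 → A ≠ B → IsCoprime A B)
    {F : k[X]} (hF : ∀ e : Fin (m + 1) → ZMod 2, e ≠ 0 → ∑ j, e j • W j ∣ F) :
    moore 2 W ∣ F := by
  set s : Finset (Fin (m + 1) → ZMod 2) := univ.erase 0 with hs
  have hs0 : ∀ e ∈ s, e ≠ 0 := fun e he => ne_of_mem_erase he
  have hpair : (s : Set (Fin (m + 1) → ZMod 2)).Pairwise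
      (Function.onFun IsCoprime fun e => ∑ j, e j • W j) := fun e he e' he' h =>
    isCoprime_sum_smul hW hcop (hs0 e he) (hs0 e' he') h
  have h1 : ∏ e ∈ s, ∑ j, e j • W j ∣ moore 2 W := prod_dvd_of_coprime hpair fun e he => by
    obtain ⟨i₀, h₀⟩ := exists_eq_one_of_ne_zero (hs0 e he)
    exact sum_smul_dvd_moore W e h₀
  have h2 : ∏ e ∈ s, ∑ j, e j • W j ∣ F := prod_dvd_of_coprime hpair fun e he => hF e (hs0 e he)
  -- There are 2^(m+1) - 1 factors of degree d, so the product dividing Δ already has full degree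
  -- and is associated to Δ.
  have hle : (moore 2 W).natDegree ≤ (∏ e ∈ s, ∑ j, e j • W j).natDegree := by
    rw [natDegree_prod _ _ fun e he => sum_smul_ne_zero hW (hs0 e he),
      sum_congr rfl fun e he => hdeg _ (sum_smul_mem_span W e) (sum_smul_ne_zero hW (hs0 e he)),
      sum_const, hs, card_erase_of_mem (mem_univ _), card_univ, Fintype.card_fun, ZMod.card,
      Fintype.card_fin, smul_eq_mul, mul_comm]
    exact natDegree_moore_le fun j => (natDegree_eq_of_span hW hdeg j).le
  exact (associated_of_dvd_of_natDegree_le h1 (moore_ne_zero_of_span hW hdeg) hle).symm.dvd.trans h2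

/-- Modulo each w the V_j are 0 or a common residue; γ is chosen by the Chinese remainder theorem to
have that residue. -/
theorem exists_moore_dvd (hW : LinearIndependent (ZMod 2) W)
    (hdeg : ∀ A ∈ Submodule.span (ZMod 2) (Set.range W), A ≠ 0 → A.natDegree = d)
    (hcop : ∀ A ∈ Submodule.span (ZMod 2) (Set.range W),
      ∀ B ∈ Submodule.span (ZMod 2) (Set.range W), A ≠ 0 → B ≠ 0 → A ≠ B → IsCoprime A B) :
    ∃ γ : k[X], ∀ j, moore 2 W ∣ mooreHat 2 W j * (mooreHat 2 W j + γ) := by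
  choose i hi using fun e : {e : Fin (m + 1) → ZMod 2 // e ≠ 0} => exists_eq_one_of_ne_zero e.2
  obtain ⟨γ, hγ⟩ := Ideal.exists_forall_sub_mem_ideal
    (I := fun e : {e : Fin (m + 1) → ZMod 2 // e ≠ 0} => Ideal.span {∑ j, e.1 j • W j})
    (fun e e' h => (Ideal.isCoprime_span_singleton_iff _ _).mpr
      (isCoprime_sum_smul hW hcop e.2 e'.2 fun h' => h (Subtype.ext h')))
    (fun e => mooreHat 2 W (i e))
  refine ⟨γ, fun j => moore_dvd_of_forall_sum_smul_dvd hW hdeg hcop fun e he => ?_⟩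
  have h1 := Ideal.mem_span_singleton.mp (hγ ⟨e, he⟩)
  have h2 := sum_smul_dvd_mooreHat W e (hi ⟨e, he⟩) j
  by_cases hj : e j = 0
  · rw [hj, zero_smul, add_zero] at h2
    exact h2.mul_right _
  · rw [zmod_two_eq_one hj, one_smul] at h2
    refine Dvd.dvd.mul_left ?_ _
    convert dvd_add h2 h1 using 1
    ring

theorem exists_polynomial_ratQ (hW : LinearIndependent (ZMod 2) W)
    (hdeg : ∀ A ∈ Submodule.span (ZMod 2) (Set.range W), A ≠ 0 → A.natDegree = d)
    (hcop : ∀ A ∈ Submodule.span (ZMod 2) (Set.range W),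
      ∀ B ∈ Submodule.span (ZMod 2) (Set.range W), A ≠ 0 → B ≠ 0 → A ≠ B → IsCoprime A B) :
    ∃ γ : k[X], ∃ Q : Fin (m + 1) → k[X], ∀ i, algebraMap k[X] (RatFunc k) (Q i) = ratQ W
      (algebraMap k[X] (RatFunc k) γ / algebraMap k[X] (RatFunc k) (moore 2 W)) i := by
  obtain ⟨γ, hγ⟩ := exists_moore_dvd hW hdeg hcop
  choose T hT using hγ
  -- Squaring V_i(V_i + γ) = ΔT_i gives V_i⁴/Δ² + (γ/Δ)²V_i² = T_i².
  refine ⟨γ, fun i => T i ^ 2 + X * mooreHat 2 W i ^ 2, fun i => ?_⟩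
  have h0 : algebraMap k[X] (RatFunc k) (moore 2 W) ≠ 0 := by
    simpa using moore_ne_zero_of_span hW hdeg
  have h1 := congrArg (algebraMap k[X] (RatFunc k)) (hT i)
  simp only [map_mul, map_add] at h1
  have h2 := congrArg (· ^ 2) h1
  simp only [mul_pow, CharTwo.add_sq] at h2
  simp only [ratQ, map_add, map_mul, map_pow, RatFunc.algebraMap_X]
  field_simp
  linear_combination -h2

/-- The polynomials `mooreHat 2 W i` have no common root. -/
theorem exists_mooreHat_eval_ne_zero (hW : LinearIndependent (ZMod 2) W)
    (hcop : ∀ A ∈ Submodule.span (ZMod 2) (Set.range W),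
      ∀ B ∈ Submodule.span (ZMod 2) (Set.range W), A ≠ 0 → B ≠ 0 → A ≠ B → IsCoprime A B)
    (a : k) : ∃ i, (mooreHat 2 W i).eval a ≠ 0 := by
  by_contra! h
  have key (i : Fin (m + 1)) : ∃ e : Fin (m + 1) → ZMod 2, e ≠ 0 ∧ e i = 0 ∧
      (∑ j, e j • W j).eval a = 0 := by
    have h1 : moore 2 (i.removeNth fun j => (W j).eval a) = 0 := by
      rw [← h i, ← coe_evalRingHom, ← mooreHat_map]
      rfl
    have h2 : ¬ LinearIndependent (ZMod 2) (i.removeNth fun j => (W j).eval a) := fun h2 =>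
      moore_ne_zero_of_linearIndependent h2 h1
    rw [Fintype.not_linearIndependent_iff] at h2
    obtain ⟨e, he, l, hl⟩ := h2
    refine ⟨i.insertNth (α := fun _ => ZMod 2) 0 e, fun h3 => hl ?_, by simp, ?_⟩
    · simpa using congrFun h3 (i.succAbove l)
    · rw [Fin.sum_univ_succAbove _ i]
      simpa [eval_finsetSum, Fin.removeNth] using he
  -- Vanishing of the i-th minor at a gives an element of the span vanishing at a with i-th
  -- coordinate 0. Choosing i where a first such element has coordinate 1 yields a distinct second
  -- one, against coprimality.
  obtain ⟨e, he, -, hea⟩ := key 0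
  obtain ⟨i, hi⟩ := exists_eq_one_of_ne_zero he
  obtain ⟨e', he', hi', hea'⟩ := key i
  obtain ⟨u, v, huv⟩ := isCoprime_sum_smul hW hcop he he' fun h' => by simp [h', hi'] at hi
  have := congrArg (eval a) huv
  simp [hea, hea', eval_add, eval_mul] at this

variable [IsAlgClosed k]

theorem span_mooreHat_eq_top (hW : LinearIndependent (ZMod 2) W)
    (hcop : ∀ A ∈ Submodule.span (ZMod 2) (Set.range W),
      ∀ B ∈ Submodule.span (ZMod 2) (Set.range W), A ≠ 0 → B ≠ 0 → A ≠ B → IsCoprime A B) :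
    Ideal.span (Set.range fun i => mooreHat 2 W i) = ⊤ := by
  obtain ⟨g, hg⟩ := (IsPrincipalIdealRing.principal
    (Ideal.span (Set.range fun i => mooreHat 2 W i))).principal
  have hdvd (i : Fin (m + 1)) : g ∣ mooreHat 2 W i := by
    rw [← Ideal.mem_span_singleton, Ideal.span, ← hg]
    exact Ideal.subset_span ⟨i, rfl⟩
  by_cases h0 : g.degree = 0
  · rw [hg]
    exact Ideal.span_singleton_eq_top.mpr (isUnit_iff_degree_eq_zero.mpr h0)
  · obtain ⟨a, ha⟩ := IsAlgClosed.exists_root g h0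
    obtain ⟨i, hi⟩ := exists_mooreHat_eval_ne_zero hW hcop a
    exact absurd (ha.dvd (hdvd i)) hi

/-- The square of (α' - α)V_i is Q'_i - Q_i, so (α' - α)V_i is a polynomial because k[X] is
integrally closed. A Bézout relation among the V_i removes the factor. -/
theorem exists_polynomial_sub (hW : LinearIndependent (ZMod 2) W)
    (hcop : ∀ A ∈ Submodule.span (ZMod 2) (Set.range W),
      ∀ B ∈ Submodule.span (ZMod 2) (Set.range W), A ≠ 0 → B ≠ 0 → A ≠ B → IsCoprime A B)
    {α α' : RatFunc k} {Q Q' : Fin (m + 1) → k[X]}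
    (hQ : ∀ i, algebraMap k[X] (RatFunc k) (Q i) = ratQ W α i)
    (hQ' : ∀ i, algebraMap k[X] (RatFunc k) (Q' i) = ratQ W α' i) :
    ∃ R : k[X], α' = α + algebraMap k[X] (RatFunc k) R := by
  have h1 (i : Fin (m + 1)) : ∃ T : k[X], algebraMap k[X] (RatFunc k) T =
      (α' - α) * algebraMap k[X] (RatFunc k) (mooreHat 2 W i) := by
    refine IsIntegrallyClosed.exists_algebraMap_eq_of_isIntegral_pow (n := 2) two_pos ?_
    have h2 : ((α' - α) * algebraMap k[X] (RatFunc k) (mooreHat 2 W i)) ^ 2 =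
        algebraMap k[X] (RatFunc k) (Q' i - Q i) := by
      rw [map_sub, hQ, hQ', ratQ, ratQ, mul_pow, CharTwo.sub_eq_add, CharTwo.add_sq,
        CharTwo.sub_eq_add]
      linear_combination (-algebraMap k[X] (RatFunc k) (mooreHat 2 W i) ^ 4 /
        algebraMap k[X] (RatFunc k) (moore 2 W) ^ 2 -
        RatFunc.X * algebraMap k[X] (RatFunc k) (mooreHat 2 W i) ^ 2) *
          CharTwo.two_eq_zero (R := RatFunc k)
    rw [h2]
    exact isIntegral_algebraMap
  choose T hT using h1
  have h3 : (1 : k[X]) ∈ Ideal.span (Set.range fun i => mooreHat 2 W i) := by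
    rw [span_mooreHat_eq_top hW hcop]
    trivial
  obtain ⟨u, hu⟩ := (Ideal.mem_span_range_iff_exists_fun).mp h3
  refine ⟨∑ i, u i * T i, ?_⟩
  rw [← sub_eq_iff_eq_add', map_sum]
  simp only [map_mul, hT]
  have h4 := congrArg (algebraMap k[X] (RatFunc k)) hu
  simp only [map_sum, map_mul, map_one] at h4
  calc α' - α = (α' - α) * ∑ i, algebraMap k[X] (RatFunc k) (u i) *
        algebraMap k[X] (RatFunc k) (mooreHat 2 W i) := by rw [h4, mul_one]
    _ = _ := by
      rw [mul_sum]
      exact sum_congr rfl fun i _ => mul_left_comm _ _ _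

end CoprimeSpan

/-! ### Existence and description of all admissible α. -/

theorem isAdmissible_iff {k : Type*} [Field k] [IsAlgClosed k] [CharP k 2] [Algebra (ZMod 2) k]
    {m d : ℕ} (hm : 1 ≤ m) {W : Fin (m + 1) → k[X]} (hW : LinearIndependent (ZMod 2) W)
    (hdeg : ∀ A ∈ Submodule.span (ZMod 2) (Set.range W), A ≠ 0 → A.natDegree = d)
    (hcop : ∀ A ∈ Submodule.span (ZMod 2) (Set.range W),
      ∀ B ∈ Submodule.span (ZMod 2) (Set.range W), A ≠ 0 → B ≠ 0 → A ≠ B → IsCoprime A B)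
    (α : RatFunc k) :
    IsAdmissible W α ↔
      ∃ Q : Fin (m + 1) → k[X], ∀ i, algebraMap k[X] (RatFunc k) (Q i) = ratQ W α i := by
  refine ⟨fun ⟨Q, hQ, _⟩ => ⟨Q, hQ⟩, fun ⟨Q, hQ⟩ => ?_⟩
  obtain ⟨γ₀, Q₀, hQ₀⟩ := exists_polynomial_ratQ hW hdeg hcop
  -- Any α making the Q_i polynomial differs from a known γ₀/Δ by a polynomial, so it too has
  -- denominator Δ.
  obtain ⟨R, rfl⟩ := exists_polynomial_sub hW hcop hQ₀ hQ
  have h0 : algebraMap k[X] (RatFunc k) (moore 2 W) ≠ 0 := by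
    simpa using moore_ne_zero_of_span hW hdeg
  have h1 : algebraMap k[X] (RatFunc k) γ₀ / algebraMap k[X] (RatFunc k) (moore 2 W) +
      algebraMap k[X] (RatFunc k) R = algebraMap k[X] (RatFunc k) (γ₀ + R * moore 2 W) /
        algebraMap k[X] (RatFunc k) (moore 2 W) := by
    rw [map_add, map_mul]
    field_simp
  rw [h1] at hQ ⊢
  exact isAdmissible_of_polynomial hm (fun j => (natDegree_eq_of_span hW hdeg j).le)
    (moore_coeff_ne_zero hW hdeg) _ hQ

theorem mainTheorem5 {k : Type*} [Field k] [IsAlgClosed k] [CharP k 2] [Algebra (ZMod 2) k]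
    {n : ℕ} (hn : 3 ≤ n) (d : ℕ) (W : Fin n → k[X])
    (hW : LinearIndependent (ZMod 2) W)
    (hdeg : ∀ A ∈ Submodule.span (ZMod 2) (Set.range W), A ≠ 0 → A.natDegree = d)
    (hcop : ∀ A ∈ Submodule.span (ZMod 2) (Set.range W),
      ∀ B ∈ Submodule.span (ZMod 2) (Set.range W), A ≠ 0 → B ≠ 0 → A ≠ B → IsCoprime A B) :
    (∃ α : RatFunc k,
      (∃ γ : k[X], α = algebraMap k[X] (RatFunc k) γ / algebraMap k[X] (RatFunc k) (moore 2 W)) ∧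
      IsAdmissible W α) ∧
    ∀ α : RatFunc k, IsAdmissible W α →
      {α' : RatFunc k | IsAdmissible W α'} =
        {α' : RatFunc k | ∃ R : k[X], α' = α + algebraMap k[X] (RatFunc k) R} := by
  obtain ⟨m, rfl⟩ := Nat.exists_eq_add_of_le' (show 1 ≤ n by omega)
  have hiff := isAdmissible_iff (by omega) hW hdeg hcop
  refine ⟨?_, fun α hα => Set.ext fun α' => ?_⟩
  · obtain ⟨γ, hγ⟩ := exists_polynomial_ratQ hW hdeg hcop
    exact ⟨_, ⟨γ, rfl⟩, (hiff _).mpr hγ⟩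
  · obtain ⟨Q, hQ⟩ := (hiff α).mp hα
    rw [Set.mem_ofPred_eq, Set.mem_ofPred_eq, hiff]
    refine ⟨fun ⟨Q', hQ'⟩ => exists_polynomial_sub hW hcop hQ hQ', ?_⟩
    rintro ⟨R, rfl⟩
    -- As (α + R)² = α² + R², the shift by R only adds R²V_i² to Q_i.
    refine ⟨fun i => Q i + R ^ 2 * mooreHat 2 W i ^ 2, fun i => ?_⟩
    rw [map_add, hQ, map_mul, map_pow, map_pow, ratQ, ratQ, CharTwo.add_sq]
    ring
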